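/- Let $T$ be a tree (an undirected connected acyclic simple graph, of arbitrary cardinality $|T|=|V(T)|$) in which every vertex lies on a double ray, i.e. on a two-sided infinite path. Let $m$ be an infinite cardinal such that $T$ has motion at least $m$, i.e. every non-identity automorphism of $T$ moves at least $m$ vertices (this holds vacuously if $T$ is asymmetric), and such that every vertex of $T$ has degree at most $2^m$. A set $S\subseteq V(T)$ is called asymmetrizing if the identity is the only $\varphi\in\operatorname{Aut}(T)$ with $\varphi(S)=S$; two sets $S,S'\subseteq V(T)$ are called equivalent if $\varphi(S)=S'$ for some $\varphi\in\operatorname{Aut}(T)$. Then: 1. the number of pairwise inequivalent asymmetrizing sets $S$ of $T$ such that every vertex of $S$ has a neighbor in $V(T)\setminus S$ is $2^{|T|}$; 2. for every vertex $w\in V(T)$, the number of pairwise inequivalent asymmetrizing sets $S_w$ of $T$ such that $w\in S_w$ and $w$ is the only vertex of $S_w$ with no neighbor in $V(T)\setminus S_w$ is $2^{|T|}$. -/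

import Mathlib

open Cardinal

universe u

namespace TreeAsym

variable {V : Type u}

/-- `v` lies on a double ray of `G`, that is, on a two-sided infinite path: a subgraph given by
pairwise distinct vertices `f n`, `n ∈ ℤ`, with `f n` adjacent to `f (n + 1)`. -/
def OnDoubleRay (G : SimpleGraph V) (v : V) : Prop :=
  ∃ f : ℤ → V, Function.Injective f ∧ (∀ n, G.Adj (f n) (f (n + 1))) ∧ v ∈ Set.range f

/-- The motion of `G`: the least number of vertices moved by a non-identity automorphism.
For an asymmetric graph the infimum is over the empty family, so its motion is `⊤`, which is
larger than every cardinal. -/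
noncomputable def motion (G : SimpleGraph V) : WithTop Cardinal.{u} :=
  ⨅ φ : {φ : G ≃g G // φ ≠ RelIso.refl _}, ((#{v : V | φ.1 v ≠ v} : Cardinal.{u}) : WithTop Cardinal.{u})

theorem le_motion_iff (G : SimpleGraph V) (m : Cardinal.{u}) :
    (m : WithTop Cardinal.{u}) ≤ motion G ↔
      ∀ φ : G ≃g G, φ ≠ RelIso.refl _ → m ≤ #{v : V | φ v ≠ v} := by
  simp only [motion, le_iInf_iff, Subtype.forall, WithTop.coe_le_coe]

/-- `S` is asymmetrizing: the identity is the only automorphism that fixes `S` setwise. -/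
def IsAsymmetrizing (G : SimpleGraph V) (S : Set V) : Prop :=
  ∀ φ : G ≃g G, φ '' S = S → φ = RelIso.refl _

/-- Two vertex sets are equivalent if some automorphism of `G` maps one onto the other. -/
def equivalentSets (G : SimpleGraph V) : Setoid (Set V) where
  r S S' := ∃ φ : G ≃g G, φ '' S = S'
  iseqv :=
    { refl := fun S => ⟨RelIso.refl _, by simp⟩
      symm := by
        rintro S _ ⟨φ, rfl⟩
        exact ⟨φ.symm, by simp [Set.image_image]⟩
      trans := by
        rintro S _ _ ⟨φ, rfl⟩ ⟨ψ, rfl⟩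
        exact ⟨φ.trans ψ, by simp [Set.image_image]⟩ }

/-- The number of pairwise inequivalent members of a family `F` of vertex sets, that is, the
number of equivalence classes that meet `F`. -/
noncomputable def numInequivalent (G : SimpleGraph V) (F : Set (Set V)) : Cardinal.{u} :=
  #((Quotient.mk (equivalentSets G)) '' F)

/-- The vertex `v` is adjacent to a vertex outside `S`. -/
def HasNeighborOutside (G : SimpleGraph V) (S : Set V) (v : V) : Prop :=
  ∃ u, G.Adj v u ∧ u ∉ S

end TreeAsym

/-! The upper bound `2 ^ #V` is trivial, so it suffices to encode each vertex set `A` injectively in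
a set of the required kind. Root the tree at `w`; automorphisms fixing `w` are the permutations
commuting with `par`.

Rigid colourings: colour vertices with infinitely many bits. If every branch has at least as many
coloured types as its root has twins, twins can be told apart at every level and a rigid colouring
exists (`exists_rigid`). Motion and the degree bound give at most `2 ^ κ` twins, `κ` being the size
of the branch (`mk_twins_le`): swapping two twins moves only their branches. That enough types exist
follows by induction on their number (`two_power_le_mk_branchTypes`): too many twins at `c` would
give the branch at the parent `2 ^ t` types, `t` being the number at `c`, and Cantor's theorem
applies.

Coding: choosing a child of each vertex partitions the non-root vertices into rays. Each ray stores
the bits of all its vertices in the pattern `b F T x ¬x T F T x ¬x T F ...`. The rays, hence the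
colours, can be recovered (`map_pc`, `eq_of_map_encode`). The initial `b`, true at most on rays from
children of `w`, makes `w` recognisable: by its distance from the code, or as its only vertex
without an outside neighbour. -/

namespace TreeAsym

/-! ### Rooted trees as parent functions -/

variable {V : Type u}

/-- `par` is the parent function of a tree with root `w`, the root being its own parent, and
`depth` decreases by one from each other vertex to its parent. -/
structure IsParentFun (par : V → V) (w : V) (depth : V → ℕ) : Prop where
  par_root : par w = w
  depth_eq : ∀ v, v ≠ w → depth v = depth (par v) + 1

/-- The descendants of `v`, including `v` itself. -/
def below (par : V → V) (v : V) : Set V := {x | ∃ n, par^[n] x = v}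

theorem mem_below_self (par : V → V) (v : V) : v ∈ below par v := ⟨0, rfl⟩

theorem par_mem_below_par {par : V → V} {v x : V} (h : x ∈ below par v) :
    x ∈ below par (par v) := by
  obtain ⟨n, rfl⟩ := h
  exact ⟨n + 1, Function.iterate_succ_apply' _ _ _⟩

theorem par_mem_below {par : V → V} {v c : V} (h : c ∈ below par v)
    (hne : c ≠ v) : par c ∈ below par v := by
  obtain ⟨_ | n, hn⟩ := h
  · exact (hne hn).elim
  · exact ⟨n, hn⟩

theorem commute_symm {par : V → V} {φ : Equiv.Perm V} (h : Function.Commute φ par) :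
    Function.Commute φ.symm par := fun x => by
  rw [Equiv.symm_apply_eq]
  simpa using (h (φ.symm x)).symm

theorem commute_trans {par : V → V} {φ ψ : Equiv.Perm V} (h : Function.Commute φ par)
    (h' : Function.Commute ψ par) : Function.Commute (φ.trans ψ) par := fun x => by
  simp only [Equiv.trans_apply, h x, h' (φ x)]

theorem map_mem_below {par : V → V} {φ : V → V} (h : Function.Commute φ par) {v x : V}
    (hx : x ∈ below par v) : φ x ∈ below par (φ v) := by
  obtain ⟨n, rfl⟩ := hx
  exact ⟨n, ((h.iterate_right n) x).symm⟩

namespace IsParentFun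

variable {par : V → V} {w : V} {depth : V → ℕ}

theorem iterate_root (hp : IsParentFun par w depth) (n : ℕ) : par^[n] w = w :=
  Function.iterate_fixed hp.par_root n

theorem par_ne (hp : IsParentFun par w depth) {v : V} (hv : v ≠ w) : par v ≠ v := fun h => by
  have := hp.depth_eq v hv
  rw [h] at this
  omega

theorem map_root (hp : IsParentFun par w depth) {φ : V → V} (h : Function.Commute φ par) :
    φ w = w := by
  by_contra hne
  exact hp.par_ne hne (by rw [← h w, hp.par_root])

theorem map_ne_root (hp : IsParentFun par w depth) {φ : Equiv.Perm V}
    (h : Function.Commute φ par) {v : V} (hv : v ≠ w) : φ v ≠ w := fun e =>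
  hv (φ.injective (e.trans (hp.map_root h).symm))

theorem depth_iterate (hp : IsParentFun par w depth) {c : V} (hc : c ≠ w) :
    ∀ (n : ℕ) {x : V}, par^[n] x = c → depth x = depth c + n
  | 0, x, h => by
    obtain rfl : x = c := h
    rfl
  | n + 1, x, h => by
    have hx : x ≠ w := by
      rintro rfl
      exact hc (h.symm.trans (hp.iterate_root _))
    have := hp.depth_iterate hc n (x := par x) h
    rw [hp.depth_eq x hx, this]
    omega

theorem exists_iterate_eq_root (hp : IsParentFun par w depth) (v : V) : ∃ n, par^[n] v = w := by
  induction h : depth v generalizing v with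
  | zero =>
    by_contra hne
    have := hp.depth_eq v (fun e => hne ⟨0, e⟩)
    omega
  | succ k ih =>
    by_cases hv : v = w
    · exact ⟨0, hv⟩
    · obtain ⟨n, hn⟩ := ih (par v) (by have := hp.depth_eq v hv; omega)
      exact ⟨n + 1, hn⟩

theorem mem_below_root (hp : IsParentFun par w depth) (v : V) : v ∈ below par w :=
  hp.exists_iterate_eq_root v

theorem ne_root_of_mem_below (hp : IsParentFun par w depth) {v c : V} (h : c ∈ below par v)
    (hne : c ≠ v) : c ≠ w := by
  rintro rfl
  obtain ⟨n, hn⟩ := h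
  exact hne (by rw [← hn, hp.iterate_root])

/-- Disjointness of the branches at distinct siblings. -/
theorem eq_of_mem_below (hp : IsParentFun par w depth) {c c' x : V} (hc : c ≠ w) (hc' : c' ≠ w)
    (hpar : par c = par c') (hx : x ∈ below par c) (hx' : x ∈ below par c') : c = c' := by
  obtain ⟨n, hn⟩ := hx
  obtain ⟨k, hk⟩ := hx'
  have h1 := hp.depth_iterate hc n hn
  have h2 := hp.depth_iterate hc' k hk
  have h3 := hp.depth_eq c hc
  have h4 := hp.depth_eq c' hc'
  rw [hpar] at h3
  obtain rfl : n = k := by omega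
  exact hn.symm.trans hk

/-- Functions on the branches at the children of `u` can be glued, together with a value
at `u`. -/
theorem exists_glue (hp : IsParentFun par w depth) {β : Type*} (u : V) (Y : V → V → β) :
    ∃ g : V → β, g u = Y u u ∧ ∀ c, c ≠ w → par c = u → ∀ x ∈ below par c, g x = Y c x := by
  -- The iterate is the ancestor of `x` one level below `u`. At `x = u` truncated subtraction makes
  -- it `u` itself.
  refine ⟨fun x => Y (par^[depth x - (depth u + 1)] x) x, ?_, ?_⟩
  · simp
  · rintro c hc rfl x ⟨n, hn⟩
    have h1 := hp.depth_iterate hc n hn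
    have h2 := hp.depth_eq c hc
    have : depth x - (depth (par c) + 1) = n := by omega
    simp only [this, hn]

end IsParentFun

/-! ### Types of coloured branches, and twins -/

/-- The colours, infinitely many bits per vertex. -/
abbrev Palette := ℕ → Bool

theorem exists_pack : ∃ e : (ℕ → Palette) → Palette, Function.Injective e :=
  ⟨((Equiv.curry ℕ ℕ Bool).symm.trans (Equiv.arrowCongr Nat.pairEquiv (Equiv.refl Bool))),
    Equiv.injective _⟩

/-- Coloured branches `(v, g)`, where only the values of `g` on the branch at `v` count, are
isomorphic if an automorphism takes one to the other. -/
def branchSetoid (par : V → V) : Setoid (V × (V → Palette)) where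
  r p q := ∃ φ : Equiv.Perm V, Function.Commute φ par ∧ φ p.1 = q.1 ∧
    ∀ x ∈ below par p.1, q.2 (φ x) = p.2 x
  iseqv :=
    { refl := fun p => ⟨Equiv.refl V, fun _ => rfl, rfl, fun _ _ => rfl⟩
      symm := by
        rintro p q ⟨φ, hφ, h, hc⟩
        have h' : φ.symm q.1 = p.1 := by rw [← h, Equiv.symm_apply_apply]
        refine ⟨φ.symm, commute_symm hφ, h', fun x hx => ?_⟩
        have := map_mem_below (commute_symm hφ) hx
        rw [h'] at this
        simpa using (hc _ this).symm
      trans := by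
        rintro p q r ⟨φ, hφ, h, hc⟩ ⟨ψ, hψ, h', hc'⟩
        refine ⟨φ.trans ψ, commute_trans hφ hψ, by simp [h, h'], fun x hx => ?_⟩
        have := map_mem_below hφ hx
        rw [h] at this
        exact (hc' _ this).trans (hc x hx) }

/-- The isomorphism type of the branch at `v` with the colouring `g`. -/
def branchType (par : V → V) (v : V) (g : V → Palette) : Quotient (branchSetoid par) :=
  Quotient.mk _ (v, g)

theorem branchType_eq_iff {par : V → V} {v v' : V} {g g' : V → Palette} :
    branchType par v g = branchType par v' g' ↔ ∃ φ : Equiv.Perm V, Function.Commute φ par ∧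
      φ v = v' ∧ ∀ x ∈ below par v, g' (φ x) = g x :=
  Quotient.eq (r := branchSetoid par)

/-- The isomorphism types of the colourings of the branch at `v`. -/
def branchTypes (par : V → V) (v : V) : Set (Quotient (branchSetoid par)) :=
  Set.range (branchType par v)

theorem branchType_congr {par : V → V} {v : V} {g g' : V → Palette}
    (h : ∀ x ∈ below par v, g x = g' x) : branchType par v g = branchType par v g' :=
  branchType_eq_iff.2 ⟨Equiv.refl V, fun _ => rfl, rfl, fun x hx => (h x hx).symm⟩

theorem branchTypes_subset {par : V → V} {φ : Equiv.Perm V} (hφ : Function.Commute φ par)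
    (v : V) : branchTypes par v ⊆ branchTypes par (φ v) := by
  rintro _ ⟨g, rfl⟩
  exact ⟨g ∘ φ.symm, branchType_eq_iff.2 ⟨φ.symm, commute_symm hφ, by simp, fun x _ => rfl⟩⟩

theorem branchTypes_map {par : V → V} {φ : Equiv.Perm V} (hφ : Function.Commute φ par)
    (v : V) : branchTypes par (φ v) = branchTypes par v :=
  (by simpa using branchTypes_subset (commute_symm hφ) (φ v) :
    branchTypes par (φ v) ⊆ branchTypes par v).antisymm (branchTypes_subset hφ v)

/-- The siblings of `c`, itself included, whose branches are isomorphic to that at `c`. -/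
def twins (par : V → V) (c : V) : Set V :=
  {c' | par c' = par c ∧ ∃ φ : Equiv.Perm V, Function.Commute φ par ∧ φ c = c'}

theorem mem_twins_self (par : V → V) (c : V) : c ∈ twins par c :=
  ⟨rfl, Equiv.refl V, fun _ => rfl, rfl⟩

theorem mem_twins_symm {par : V → V} {c c' : V} (h : c' ∈ twins par c) : c ∈ twins par c' := by
  obtain ⟨h, φ, hφ, rfl⟩ := h
  exact ⟨h.symm, φ.symm, commute_symm hφ, by simp⟩

theorem mem_twins_trans {par : V → V} {c c' c'' : V} (h : c' ∈ twins par c)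
    (h' : c'' ∈ twins par c') : c'' ∈ twins par c := by
  obtain ⟨h, φ, hφ, rfl⟩ := h
  obtain ⟨h', ψ, hψ, rfl⟩ := h'
  exact ⟨h'.trans h, φ.trans ψ, commute_trans hφ hψ, by simp⟩

theorem twins_eq {par : V → V} {c c' : V} (h : c' ∈ twins par c) : twins par c' = twins par c :=
  Set.ext fun _ => ⟨mem_twins_trans h, mem_twins_trans (mem_twins_symm h)⟩

theorem branchTypes_eq_of_mem_twins {par : V → V} {c c' : V} (h : c' ∈ twins par c) :
    branchTypes par c' = branchTypes par c := by
  obtain ⟨-, φ, hφ, rfl⟩ := h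
  exact branchTypes_map hφ c

theorem IsParentFun.ne_root_of_mem_twins {par : V → V} {w : V} {depth : V → ℕ}
    (hp : IsParentFun par w depth) {c c' : V} (hc : c ≠ w) (h : c' ∈ twins par c) : c' ≠ w := by
  obtain ⟨-, φ, hφ, rfl⟩ := h
  exact hp.map_ne_root hφ hc

end TreeAsym

/-! ### Counting types and building rigid colourings -/

namespace TreeAsym

namespace IsParentFun

variable {V : Type u} {par : V → V} {w : V} {depth : V → ℕ}

/-- Copy a colouring of the branch at `c` into layer 0 and mark that branch in the other layers; the
mark forces an isomorphism at the parent to fix `c`. -/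
theorem mk_branchTypes_le_par (hp : IsParentFun par w depth) {c : V} (hc : c ≠ w) :
    #(branchTypes par c) ≤ #(branchTypes par (par c)) := by
  classical
  obtain ⟨e, he⟩ := exists_pack
  have hrep : ∀ t : branchTypes par c, ∃ g, branchType par c g = t := fun t => t.2
  choose rep hrep using hrep
  have hglue : ∀ t : branchTypes par c, ∃ g : V → Palette,
      ∀ c', c' ≠ w → par c' = par c → ∀ x ∈ below par c',
        g x = e fun n => if n = 0 then rep t x else fun _ => decide (c' = c) := fun t =>
    (hp.exists_glue (par c)
      fun c' x => e fun n => if n = 0 then rep t x else fun _ => decide (c' = c)).imp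
      fun _ h => h.2
  choose g hg using hglue
  refine Cardinal.mk_le_of_injective (f := fun t => ⟨branchType par (par c) (g t), g t, rfl⟩) ?_
  intro t t' htt
  obtain ⟨φ, hφ, hpar, hcol⟩ := branchType_eq_iff.1 (Subtype.ext_iff.1 htt)
  have key : ∀ x ∈ below par c, φ c = c ∧ rep t' (φ x) = rep t x := fun x hx => by
    have h := hcol x (par_mem_below_par hx)
    rw [hg t c hc rfl x hx, hg t' (φ c) (hp.map_ne_root hφ hc) ((hφ c).symm.trans hpar) (φ x)
      (map_mem_below hφ hx)] at h
    have h := he h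
    have h0 := congrFun h 0
    have h1 := congrFun (congrFun h 1) 0
    simp only [one_ne_zero, if_false, decide_true, decide_eq_true_eq] at h1
    exact ⟨h1, by simpa using h0⟩
  apply Subtype.ext
  rw [← hrep t, ← hrep t']
  exact branchType_eq_iff.2 ⟨φ, hφ, (key c (mem_below_self par c)).1, fun x hx => (key x hx).2⟩

theorem mk_branchTypes_le_of_mem_below (hp : IsParentFun par w depth) {v c : V}
    (h : c ∈ below par v) : #(branchTypes par c) ≤ #(branchTypes par v) := by
  obtain ⟨n, hn⟩ := h
  induction n generalizing c with
  | zero => obtain rfl : c = v := hn; exact le_rfl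
  | succ k ih =>
    by_cases hc : c = w
    · obtain rfl : c = v := by rw [← hn, hc, hp.iterate_root]
      exact le_rfl
    · exact (hp.mk_branchTypes_le_par hc).trans (ih hn)

/-- If `c` has at least as many twins as its branch has colourings up to isomorphism, then sets
of such colourings are told apart by the branch at the parent. -/
theorem two_power_le_of_le_twins (hp : IsParentFun par w depth) {c : V} (hc : c ≠ w)
    (h : #(branchTypes par c) ≤ #(twins par c)) :
    2 ^ #(branchTypes par c) ≤ #(branchTypes par (par c)) := by
  classical
  let t₀ : branchTypes par c := ⟨branchType par c fun _ _ => false, _, rfl⟩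
  have : Nonempty (branchTypes par c) := ⟨t₀⟩
  obtain ⟨i⟩ := Cardinal.le_def _ _ |>.1 h
  have hs : Function.Surjective (Function.invFun i) := Function.invFun_surjective i.injective
  set s := Function.invFun i
  have hrep : ∀ (t : branchTypes par c) (c' : V), ∃ g, c' ∈ twins par c →
      branchType par c' g = t := fun t c' => by
    by_cases hc' : c' ∈ twins par c
    · obtain ⟨g, hg⟩ : (t : Quotient _) ∈ branchTypes par c' := by
        rw [branchTypes_eq_of_mem_twins hc']; exact t.2
      exact ⟨g, fun _ => hg⟩
    · exact ⟨fun _ _ => false, fun h => (hc' h).elim⟩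
  choose rep hrep using hrep
  -- The surjection `s` from twins to types realises every type in `A`; twins with a type outside
  -- `A` fall back to `t₀`. Whether `t₀ ∈ A` is thereby lost, so it is recorded in the colour of
  -- `par c`.
  let τ : Set (branchTypes par c) → V → branchTypes par c := fun A c' =>
    if hc' : c' ∈ twins par c then if s ⟨c', hc'⟩ ∈ A then s ⟨c', hc'⟩ else t₀ else t₀
  have hτ : ∀ A t, (∃ c' ∈ twins par c, τ A c' = t) ∨ t = t₀ ↔ t ∈ A ∨ t = t₀ := by
    intro A t
    constructor
    · rintro (⟨c', hc', rfl⟩ | rfl)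
      · by_cases h1 : s ⟨c', hc'⟩ ∈ A <;> simp [τ, hc', h1]
      · exact Or.inr rfl
    · rintro (ht | rfl)
      · obtain ⟨⟨c', hc'⟩, rfl⟩ := hs t
        exact Or.inl ⟨c', hc', by simp [τ, hc', ht]⟩
      · exact Or.inr rfl
  have hglue := fun A : Set (branchTypes par c) => hp.exists_glue (par c)
    fun c' x => if c' = par c then fun _ => decide (t₀ ∈ A) else rep (τ A c') c' x
  choose g hgp hg using hglue
  have hg : ∀ A, ∀ c' ∈ twins par c, branchType par c' (g A) = τ A c' := fun A c' hc' => by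
    rw [← hrep (τ A c') c' hc']
    refine branchType_congr fun x hx => ?_
    have hw := hp.ne_root_of_mem_twins hc hc'
    rw [hg A c' hw hc'.1 x hx, if_neg]
    exact fun e => hp.par_ne hw (hc'.1.trans e.symm)
  rw [← Cardinal.mk_set]
  refine Cardinal.mk_le_of_injective (f := fun A => ⟨branchType par (par c) (g A), g A, rfl⟩) ?_
  have hsub : ∀ A B, branchType par (par c) (g A) = branchType par (par c) (g B) → A ⊆ B := by
    intro A B hAB t ht
    obtain ⟨φ, hφ, hpar, hcol⟩ := branchType_eq_iff.1 hAB
    have h₀ : t₀ ∈ A ↔ t₀ ∈ B := by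
      have := hcol _ (mem_below_self par _)
      rw [hpar, hgp, hgp] at this
      simpa using (congrFun this 0).symm
    by_cases ht₀ : t = t₀
    · subst ht₀; exact h₀.1 ht
    obtain ⟨c', hc', hct⟩ := ((hτ A t).2 (Or.inl ht)).resolve_right ht₀
    have hφc : φ c' ∈ twins par c :=
      mem_twins_trans hc' ⟨by rw [← hφ, hc'.1, hpar], φ, hφ, rfl⟩
    refine ((hτ B t).1 (Or.inl ⟨φ c', hφc, ?_⟩)).resolve_right ht₀
    rw [← hct]
    apply Subtype.ext
    rw [← hg A c' hc', ← hg B _ hφc]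
    refine (branchType_eq_iff.2 ⟨φ, hφ, rfl, fun x hx => hcol x ?_⟩).symm
    have := par_mem_below_par hx
    rwa [hc'.1] at this
  intro A B hAB
  have hAB := Subtype.ext_iff.1 hAB
  exact (hsub A B hAB).antisymm (hsub B A hAB.symm)

/-- If below `v` distinct twins can be given non-isomorphic colourings, then the branch at `v`
has a colouring that no non-trivial automorphism preserves. -/
theorem exists_rigid (hp : IsParentFun par w depth) {v : V}
    (h : ∀ c ∈ below par v, c ≠ v → #(twins par c) ≤ #(branchTypes par c)) :
    ∃ f : V → Palette, ∀ φ : Equiv.Perm V, Function.Commute φ par → φ v = v →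
      (∀ x ∈ below par v, f (φ x) = f x) → ∀ x ∈ below par v, φ x = x := by
  classical
  obtain ⟨e, he⟩ := exists_pack
  -- The injection depends only on the two sets, not on `c`, so all twins share it and receive
  -- distinct types.
  have hj : ∀ (A : Set V) (B : Set (Quotient (branchSetoid par))),
      ∃ j : V → Quotient (branchSetoid par), #A ≤ #B → Set.InjOn j A ∧ Set.MapsTo j A B := by
    intro A B
    by_cases hAB : #A ≤ #B
    · obtain ⟨i⟩ := Cardinal.le_def _ _ |>.1 hAB
      refine ⟨fun x => if hx : x ∈ A then i ⟨x, hx⟩ else branchType par x fun _ _ => false,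
        fun _ => ⟨fun x hx y hy hxy => ?_, fun x hx => ?_⟩⟩
      · simp only [hx, hy, dif_pos] at hxy
        exact Subtype.ext_iff.1 (i.injective (Subtype.ext hxy))
      · simp only [hx, dif_pos]
        exact (i _).2
    · exact ⟨fun x => branchType par x fun _ _ => false, fun h => (hAB h).elim⟩
  choose j hj using hj
  have hy : ∀ c, ∃ y : V → Palette, c ∈ below par v → c ≠ v →
      branchType par c y = j (twins par c) (branchTypes par c) c := fun c => by
    by_cases hcv : c ∈ below par v ∧ c ≠ v
    · obtain ⟨y, hy⟩ := (hj _ _ (h c hcv.1 hcv.2)).2 (mem_twins_self par c)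
      exact ⟨y, fun _ _ => hy⟩
    · exact ⟨fun _ _ => false, fun h1 h2 => (hcv ⟨h1, h2⟩).elim⟩
  choose y hy using hy
  -- Overlay the chosen colourings of all branches containing `x`: layer `k` comes from the `k`-th
  -- ancestor. Going down from `v`, once the parent of `x` is fixed, `φ x` is a twin of `x` of the
  -- same type, hence equals `x`.
  refine ⟨fun x => e fun k => y (par^[k] x) x, fun φ hφ hv hcol x hx => ?_⟩
  obtain ⟨n, hn⟩ := hx
  induction n generalizing x with
  | zero => obtain rfl : x = v := hn; exact hv
  | succ n ih =>
    by_cases hxv : x = v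
    · rw [hxv, hv]
    have hxw := hp.ne_root_of_mem_below ⟨_, hn⟩ hxv
    have hpar : φ (par x) = par x := ih (par x) hn
    have hb : x ∈ below par v := ⟨_, hn⟩
    have htw : φ x ∈ twins par x := ⟨by rw [← hφ, hpar], φ, hφ, rfl⟩
    have hb' : φ x ∈ below par v := by simpa [hv] using map_mem_below hφ hb
    have hxv' : φ x ≠ v := fun e => hxv (φ.injective (e.trans hv.symm))
    have hjj := (hj _ _ (h x hb hxv)).1 htw (mem_twins_self par x)
    refine hjj ?_
    have h1 := hy (φ x) hb' hxv'
    rw [twins_eq htw, branchTypes_eq_of_mem_twins htw] at h1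
    rw [← h1, ← hy x hb hxv]
    refine (branchType_eq_iff.2 ⟨φ, hφ, rfl, fun z hz => ?_⟩).symm
    obtain ⟨k, hk⟩ := hz
    have hzv : z ∈ below par v := ⟨n + 1 + k, by rw [Function.iterate_add_apply, hk, hn]⟩
    have := congrFun (he (hcol z hzv)) k
    rwa [← (hφ.iterate_right k) z, hk] at this

/-- Adding the indicator of a subset of the branch to a rigid colouring gives different types for
different subsets. -/
theorem two_power_le_of_twins_le (hp : IsParentFun par w depth) {v : V}
    (h : ∀ c ∈ below par v, c ≠ v → #(twins par c) ≤ #(branchTypes par c)) :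
    2 ^ #(below par v) ≤ #(branchTypes par v) := by
  classical
  obtain ⟨e, he⟩ := exists_pack
  obtain ⟨f, hf⟩ := hp.exists_rigid h
  let g : Set (below par v) → V → Palette := fun A x =>
    e fun n => if n = 0 then f x else fun _ => decide (∃ hx : x ∈ below par v, ⟨x, hx⟩ ∈ A)
  rw [← Cardinal.mk_set]
  refine Cardinal.mk_le_of_injective (f := fun A => ⟨branchType par v (g A), g A, rfl⟩) ?_
  intro A B hAB
  obtain ⟨φ, hφ, hv, hcol⟩ := branchType_eq_iff.1 (Subtype.ext_iff.1 hAB)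
  have hcol : ∀ x ∈ below par v, f (φ x) = f x ∧
      ((∃ hx : φ x ∈ below par v, ⟨φ x, hx⟩ ∈ B) ↔ ∃ hx : x ∈ below par v, ⟨x, hx⟩ ∈ A) :=
    fun x hx => by
      have := he (hcol x hx)
      have h0 := congrFun this 0
      have h1 := congrFun (congrFun this 1) 0
      exact ⟨by simpa using h0, by simpa using h1⟩
  have hid := hf φ hφ hv fun x hx => (hcol x hx).1
  ext ⟨x, hx⟩
  have := (hcol x hx).2
  rw [hid x hx] at this
  simpa [hx] using this.symm

/-- If no vertex has more than `2 ^ κ` twins, `κ` being the size of its branch, then each branch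
has as many colourings up to isomorphism as it has vertex sets. -/
theorem two_power_le_mk_branchTypes (hp : IsParentFun par w depth)
    (h : ∀ c, c ≠ w → #(twins par c) ≤ 2 ^ #(below par c)) (v : V) :
    2 ^ #(below par v) ≤ #(branchTypes par v) := by
  induction hN : #(branchTypes par v) using WellFoundedLT.induction generalizing v with
  | ind N ih =>
    rw [← hN]
    refine hp.two_power_le_of_twins_le fun c hc hcv => ?_
    have hcw := hp.ne_root_of_mem_below hc hcv
    have h1 := hp.mk_branchTypes_le_par hcw
    have h2 := hp.mk_branchTypes_le_of_mem_below (par_mem_below hc hcv)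
    -- Types can only increase towards `v`. If `c` has fewer than `v`, induction applies; otherwise
    -- it has equally many, and an excess of twins would give `2 ^ N ≤ N`.
    by_cases hlt : #(branchTypes par c) < N
    · exact (h c hcw).trans (ih _ hlt c rfl)
    · by_contra hcon
      have h3 := hp.two_power_le_of_le_twins hcw (not_le.1 hcon).le
      exact hlt (((Cardinal.cantor _).trans_le (h3.trans h2)).trans_eq hN)

theorem exists_rigid_root (hp : IsParentFun par w depth)
    (h : ∀ c, c ≠ w → #(twins par c) ≤ 2 ^ #(below par c)) :
    ∃ f : V → Palette, ∀ φ : Equiv.Perm V, Function.Commute φ par →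
      (∀ x, f (φ x) = f x) → ∀ x, φ x = x := by
  obtain ⟨f, hf⟩ := hp.exists_rigid (v := w) fun c hc hcw =>
    (h c hcw).trans (hp.two_power_le_mk_branchTypes h c)
  exact ⟨f, fun φ hφ hcol x => hf φ hφ (hp.map_root hφ) (fun x _ => hcol x) x
    (hp.mem_below_root x)⟩

end IsParentFun

end TreeAsym

/-! ### Coding a colouring as a vertex set along rays -/

namespace TreeAsym

/-- The colour of the vertex at position `n` of a ray that carries the bits `x`. -/
def rayColour (b : Bool) (x : ℕ → Bool) (n : ℕ) : Bool :=
  if n = 0 then b else if n % 5 = 1 then false else if n % 5 = 2 then true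
    else if n % 5 = 3 then x (n / 5) else if n % 5 = 4 then !x (n / 5) else true

theorem rayColour_zero (b : Bool) (x : ℕ → Bool) : rayColour b x 0 = b := rfl

theorem rayColour_one (b : Bool) (x : ℕ → Bool) : rayColour b x 1 = false := rfl

theorem rayColour_bit (b : Bool) (x : ℕ → Bool) (k : ℕ) : rayColour b x (5 * k + 3) = x k := by
  have h1 : (5 * k + 3) % 5 = 3 := by omega
  have h2 : (5 * k + 3) / 5 = k := by omega
  simp [rayColour, h1, h2]

/-- Only position 0 may start two consecutive `false` values; this is what marks the start of a ray.
-/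
theorem rayColour_or_succ (b b' : Bool) (x : ℕ → Bool) {n : ℕ} (hn : n ≠ 0) :
    rayColour b x n = true ∨ rayColour b' x (n + 1) = true := by
  have : n % 5 < 5 := Nat.mod_lt _ (by norm_num)
  interval_cases h : n % 5
  · simp [rayColour, hn, h]
  · right; simp [rayColour, Nat.add_mod, h]
  · simp [rayColour, hn, h]
  · have h1 : (n + 1) / 5 = n / 5 := by omega
    cases h2 : x (n / 5) <;> simp [rayColour, hn, h, Nat.add_mod, h1, h2]
  · have h1 : (n + 1) % 5 = 0 := by omega
    right; simp [rayColour, h1]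

/-- Storing each bit next to its negation gives every `true` a `false` neighbour on the ray, found
without using position 0. -/
theorem rayColour_succ_or_pred (b b' : Bool) (x : ℕ → Bool) {n : ℕ}
    (h : rayColour b x n = true) : rayColour b' x (n + 1) = false ∨
      ∃ k, k ≠ 0 ∧ n = k + 1 ∧ rayColour b' x k = false := by
  have : n % 5 < 5 := Nat.mod_lt _ (by norm_num)
  by_cases hn : n = 0
  · subst hn; exact Or.inl rfl
  interval_cases hm : n % 5
  · left; simp [rayColour, Nat.add_mod, hm]
  · simp [rayColour, hn, hm] at h
  · have h1 : (n - 1) % 5 = 1 := by omega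
    exact Or.inr ⟨n - 1, by omega, by omega, by simp [rayColour, h1]; omega⟩
  · have h1 : (n + 1) / 5 = n / 5 := by omega
    simp only [rayColour, hn, hm] at h
    left; simp_all [rayColour, Nat.add_mod]
  · have h1 : (n - 1) / 5 = n / 5 := by omega
    have h2 : (n - 1) % 5 = 3 := by omega
    have h3 : n - 1 ≠ 0 := by omega
    simp only [rayColour, hn, hm] at h
    exact Or.inr ⟨n - 1, h3, by omega, by simp_all [rayColour]⟩

variable {V : Type u}

/-- `pc` chooses a child of each vertex. -/
def IsChildFun (par : V → V) (w : V) (pc : V → V) : Prop := ∀ v, pc v ≠ w ∧ par (pc v) = v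

/-- The vertices at which a new ray of chosen children begins. -/
def IsRayStart (par : V → V) (w : V) (pc : V → V) (v : V) : Prop := par v = w ∨ pc (par v) ≠ v

/-- The position of `v` on its ray of chosen children. -/
noncomputable def rayPos (par : V → V) (w : V) (pc : V → V) (v : V) : ℕ :=
  sInf {n | IsRayStart par w pc (par^[n] v)}

/-- The first vertex of the ray of chosen children that `v` lies on. -/
noncomputable def rayBase (par : V → V) (w : V) (pc : V → V) (v : V) : V :=
  par^[rayPos par w pc v] v

/-- The bits of the colours of all vertices of the ray of chosen children from `c`. -/
def rayBits (pc : V → V) (x : V → Palette) (c : V) (k : ℕ) : Bool :=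
  x (pc^[k.unpair.1] c) k.unpair.2

open Classical in
/-- The vertex set that encodes the colouring `x`. The root belongs to it if and only if its
children do, as told by `b`. -/
noncomputable def encode (par : V → V) (w : V) (pc : V → V) (b : Bool) (x : V → Palette) : Set V :=
  {v | (if v = w then b else rayColour (b && decide (par v = w))
    (rayBits pc x (rayBase par w pc v)) (rayPos par w pc v)) = true}

namespace IsParentFun

variable {par : V → V} {w : V} {depth : V → ℕ} {pc : V → V}

theorem rayPos_of_isRayStart {v : V} (h : IsRayStart par w pc v) : rayPos par w pc v = 0 :=
  Nat.sInf_eq_zero.2 (Or.inl h)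

theorem rayPos_of_not_isRayStart (hp : IsParentFun par w depth) {v : V}
    (h : ¬ IsRayStart par w pc v) : rayPos par w pc v = rayPos par w pc (par v) + 1 := by
  classical
  have h2 : ∃ n, IsRayStart par w pc (par^[n] (par v)) := by
    obtain ⟨n, hn⟩ := hp.exists_iterate_eq_root (par v)
    exact ⟨n, Or.inl (by rw [hn, hp.par_root])⟩
  have h1 : ∃ n, IsRayStart par w pc (par^[n] v) := h2.imp' (· + 1) fun _ h => h
  exact ((Nat.sInf_def h1).trans (Nat.find_comp_succ h1 h2 h)).trans
    (congrArg (· + 1) (Nat.sInf_def h2).symm)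

theorem rayBase_of_not_isRayStart (hp : IsParentFun par w depth) {v : V}
    (h : ¬ IsRayStart par w pc v) : rayBase par w pc v = rayBase par w pc (par v) := by
  rw [rayBase, hp.rayPos_of_not_isRayStart h, Function.iterate_succ_apply, rayBase]

theorem not_isRayStart_pc (hpc : IsChildFun par w pc) {v : V} (hv : v ≠ w) :
    ¬ IsRayStart par w pc (pc v) := by
  simp [IsRayStart, (hpc v).2, hv]

theorem rayPos_iterate (hp : IsParentFun par w depth) (hpc : IsChildFun par w pc) {v : V}
    (hv : v ≠ w) (k : ℕ) : pc^[k] v ≠ w ∧ rayPos par w pc (pc^[k] v) = rayPos par w pc v + k ∧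
      rayBase par w pc (pc^[k] v) = rayBase par w pc v := by
  induction k with
  | zero => exact ⟨hv, rfl, rfl⟩
  | succ k ih =>
    have h := not_isRayStart_pc hpc ih.1
    rw [Function.iterate_succ_apply', hp.rayPos_of_not_isRayStart h,
      hp.rayBase_of_not_isRayStart h, (hpc _).2, ih.2.1, ih.2.2]
    exact ⟨(hpc _).1, by omega, rfl⟩

theorem iterate_rayBase (hp : IsParentFun par w depth) {v : V} (hv : v ≠ w) :
    rayBase par w pc v ≠ w ∧ pc^[rayPos par w pc v] (rayBase par w pc v) = v := by
  induction hn : rayPos par w pc v generalizing v with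
  | zero => simp [rayBase, hn, hv]
  | succ n ih =>
    have h : ¬ IsRayStart par w pc v := fun h => by
      rw [rayPos_of_isRayStart h] at hn; omega
    have h1 := hp.rayPos_of_not_isRayStart h
    simp only [IsRayStart, not_or, not_not] at h
    have h2 := ih (v := par v) h.1 (by omega)
    rw [hp.rayBase_of_not_isRayStart (by simp [IsRayStart, h]), Function.iterate_succ_apply', h2.2]
    exact ⟨h2.1, h.2⟩

variable {b : Bool} {x x' : V → Palette}

theorem root_mem_encode : w ∈ encode par w pc b x ↔ b = true := by
  simp [encode]

theorem mem_encode {v : V} (hv : v ≠ w) : v ∈ encode par w pc b x ↔ ∃ b', (par v ≠ w → b' = false)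
    ∧ (par v = w → b' = b) ∧
    rayColour b' (rayBits pc x (rayBase par w pc v)) (rayPos par w pc v) = true := by
  by_cases h : par v = w <;> simp [encode, hv, h]

theorem mem_encode_of_isRayStart {v : V} (hv : v ≠ w) (h : IsRayStart par w pc v) :
    v ∈ encode par w pc b x ↔ par v = w ∧ b = true := by
  rw [mem_encode hv, rayPos_of_isRayStart h]
  by_cases h : par v = w <;> simp [h, rayColour_zero]

theorem mem_encode_of_rayPos_ne_zero {v : V} (hv : v ≠ w) (h : rayPos par w pc v ≠ 0) (b' : Bool) :
    v ∈ encode par w pc b x ↔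
      rayColour b' (rayBits pc x (rayBase par w pc v)) (rayPos par w pc v) = true := by
  rw [encode, Set.mem_ofPred_eq, if_neg hv]
  simp only [rayColour, h, if_false]

theorem mem_encode_iterate_pc (hp : IsParentFun par w depth) (hpc : IsChildFun par w pc) {v : V}
    (hv : v ≠ w) (b' : Bool) {k : ℕ} (hk : k ≠ 0) :
    pc^[k] v ∈ encode par w pc b x ↔
      rayColour b' (rayBits pc x (rayBase par w pc v)) (rayPos par w pc v + k) = true := by
  obtain ⟨h1, h2, h3⟩ := hp.rayPos_iterate hpc hv k
  rw [mem_encode_of_rayPos_ne_zero h1 (by omega) b', h2, h3]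

theorem mem_encode_pc (hp : IsParentFun par w depth) (hpc : IsChildFun par w pc) {v : V}
    (hv : v ≠ w) (b' : Bool) : pc v ∈ encode par w pc b x ↔
      rayColour b' (rayBits pc x (rayBase par w pc v)) (rayPos par w pc v + 1) = true :=
  hp.mem_encode_iterate_pc hpc hv b' one_ne_zero

theorem mem_or_pc_mem_encode (hp : IsParentFun par w depth) (hpc : IsChildFun par w pc) {v : V}
    (hv : v ≠ w) (h : rayPos par w pc v ≠ 0) :
    v ∈ encode par w pc b x ∨ pc v ∈ encode par w pc b x := by
  rw [mem_encode_of_rayPos_ne_zero hv h false,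
    hp.mem_encode_pc hpc hv false]
  exact rayColour_or_succ _ _ _ h

theorem pc_notMem_encode (hp : IsParentFun par w depth) (hpc : IsChildFun par w pc) {v : V}
    (hv : v ≠ w) (h : rayPos par w pc v = 0) : pc v ∉ encode par w pc b x := by
  rw [hp.mem_encode_pc hpc hv false, h]
  simp [rayColour_one]

theorem exists_mem_encode (hp : IsParentFun par w depth) (hpc : IsChildFun par w pc) {v : V}
    (hv : v ≠ w) : v ∈ encode par w pc b x ∨ pc v ∈ encode par w pc b x ∨
      pc (pc v) ∈ encode par w pc b x := by
  by_cases h : rayPos par w pc v = 0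
  · right; right
    exact (hp.mem_encode_iterate_pc hpc hv false two_ne_zero).2 (by rw [h]; rfl)
  · exact (hp.mem_or_pc_mem_encode hpc hv h).imp_right Or.inl

theorem exists_notMem_encode (hp : IsParentFun par w depth) (hpc : IsChildFun par w pc) {v : V}
    (hv : v ≠ w) (h : v ∈ encode par w pc b x) :
    pc v ∉ encode par w pc b x ∨ par v ∉ encode par w pc b x := by
  rw [hp.mem_encode_pc hpc hv false]
  obtain ⟨b', -, -, h⟩ := (mem_encode hv).1 h
  refine (rayColour_succ_or_pred b' false _ h).imp (by simp) ?_
  rintro ⟨k, hk, hk', hc⟩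
  have hs : ¬ IsRayStart par w pc v := fun hs => by
    rw [rayPos_of_isRayStart hs] at hk'; omega
  have h1 := hp.rayPos_of_not_isRayStart hs
  obtain rfl : k = rayPos par w pc (par v) := by omega
  rw [mem_encode_of_rayPos_ne_zero (fun e => hs (Or.inl e)) hk false,
    ← hp.rayBase_of_not_isRayStart hs]
  simpa using hc

/-- An unchosen child `c` starts a ray, so `c` and its chosen child (position 1) are outside the
code, as are its other children, which start rays too. On a chosen child, one of two successive ray
positions is inside. -/
theorem eq_pc_iff (hp : IsParentFun par w depth) (hpc : IsChildFun par w pc) {c : V} (hc : c ≠ w)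
    (hc' : par c ≠ w) : (c ∈ encode par w pc b x ∨
      ∃ d, d ≠ w ∧ par d = c ∧ d ∈ encode par w pc b x) ↔ pc (par c) = c := by
  constructor
  · intro h
    by_contra hne
    have hs : IsRayStart par w pc c := Or.inr hne
    rw [mem_encode_of_isRayStart hc hs] at h
    obtain ⟨d, hd, rfl, hmem⟩ := h.resolve_left fun h => hc' h.1
    by_cases hds : IsRayStart par w pc d
    · exact hc ((mem_encode_of_isRayStart hd hds).1 hmem).1
    · simp only [IsRayStart, not_or, not_not] at hds
      have := hp.pc_notMem_encode hpc (b := b) (x := x) hc (rayPos_of_isRayStart hs)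
      rw [hds.2] at this
      exact this hmem
  · intro h
    have hs : ¬ IsRayStart par w pc c := by simp [IsRayStart, hc', h]
    refine (hp.mem_or_pc_mem_encode hpc hc ?_).imp_right fun h => ⟨pc c, (hpc c).1, (hpc c).2, h⟩
    rw [hp.rayPos_of_not_isRayStart hs]
    omega

theorem map_pc (hp : IsParentFun par w depth) (hpc : IsChildFun par w pc) {φ : Equiv.Perm V}
    (hφ : Function.Commute φ par)
    (h : ∀ v, φ v ∈ encode par w pc b x' ↔ v ∈ encode par w pc b x) {v : V} (hv : v ≠ w) :
    φ (pc v) = pc (φ v) := by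
  have h1 := (hp.eq_pc_iff (b := b) (x := x) hpc (hpc v).1 (by rwa [(hpc v).2])).2 (by rw [(hpc v).2])
  have hpar : par (φ (pc v)) = φ v := by rw [← hφ, (hpc v).2]
  rw [← hpar, eq_comm]
  refine (hp.eq_pc_iff (b := b) (x := x') hpc (hp.map_ne_root hφ (hpc v).1) ?_).1 ?_
  · rw [hpar]; exact hp.map_ne_root hφ hv
  · rw [h]
    refine h1.imp_right ?_
    rintro ⟨d, hd, hd', hmem⟩
    exact ⟨φ d, hp.map_ne_root hφ hd, by rw [← hφ, hd'], (h d).2 hmem⟩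

/-- The colouring can be read off its code. -/
theorem eq_of_map_encode (hp : IsParentFun par w depth) (hpc : IsChildFun par w pc)
    {φ : Equiv.Perm V} (hφ : Function.Commute φ par)
    (h : ∀ v, φ v ∈ encode par w pc b x' ↔ v ∈ encode par w pc b x) {v : V} (hv : v ≠ w) :
    x' (φ v) = x v := by
  have hroot : ∀ v, φ v = w ↔ v = w := fun v =>
    ⟨fun e => by_contra fun hv => hp.map_ne_root hφ hv e, fun e => e ▸ hp.map_root hφ⟩
  have hs : ∀ v, IsRayStart par w pc (φ v) ↔ IsRayStart par w pc v := fun v => by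
    rw [IsRayStart, IsRayStart, ← hφ, hroot]
    by_cases hv : par v = w
    · simp [hv]
    · simp [hv, ← hp.map_pc hpc hφ h hv]
  have hpos : ∀ v, rayPos par w pc (φ v) = rayPos par w pc v := fun v => by
    simp only [rayPos, ← (hφ.iterate_right _) v, hs]
  have hbase : ∀ v, rayBase par w pc (φ v) = φ (rayBase par w pc v) := fun v => by
    rw [rayBase, rayBase, hpos, ← (hφ.iterate_right _) v]
  have hbits : rayBits pc x' (φ (rayBase par w pc v)) = rayBits pc x (rayBase par w pc v) := by
    funext k
    obtain ⟨hbw, hbv⟩ := hp.iterate_rayBase (pc := pc) hv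
    obtain ⟨-, h2, h3⟩ := hp.rayPos_iterate hpc hbw (rayPos par w pc v)
    rw [hbv] at h2 h3
    obtain ⟨h4, h5, h6⟩ := hp.rayPos_iterate hpc hbw (5 * k + 3)
    have h0 : rayPos par w pc (rayBase par w pc v) = 0 := by omega
    have := h (pc^[5 * k + 3] (rayBase par w pc v))
    rw [mem_encode_of_rayPos_ne_zero h4 (by omega) false,
      mem_encode_of_rayPos_ne_zero (hp.map_ne_root hφ h4) (by rw [hpos]; omega) false, hpos, hbase,
      h5, h6, h0, ← h3, zero_add, rayColour_bit, rayColour_bit] at this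
    exact Bool.eq_iff_iff.2 this
  funext j
  -- The base of the ray stores the bit `j` of the vertex at its position `p` at index `Nat.pair p
  -- j`.
  have := congrFun hbits (Nat.pair (rayPos par w pc v) j)
  simp only [rayBits, Nat.unpair_pair, ← hbase] at this
  have h1 := (hp.iterate_rayBase (pc := pc) (hp.map_ne_root hφ hv)).2
  rw [hpos] at h1
  rwa [h1, (hp.iterate_rayBase (pc := pc) hv).2] at this

theorem far_root_notMem_encode (hp : IsParentFun par w depth) (hpc : IsChildFun par w pc) {c d : V}
    (hc : par c = w) (hd : par d = c) :
    c ∉ encode par w pc false x ∧ d ∉ encode par w pc false x := by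
  have h1 : ∀ c, par c = w → c ∉ encode par w pc false x := fun c hc => by
    by_cases hcw : c = w
    · rw [hcw, root_mem_encode]; simp
    · rw [mem_encode_of_isRayStart hcw (Or.inl hc)]; simp
  refine ⟨h1 c hc, ?_⟩
  by_cases hcw : c = w
  · exact h1 d (hd.trans hcw)
  have hdw : d ≠ w := by rintro rfl; exact hcw (by rw [← hd, hp.par_root])
  by_cases hds : IsRayStart par w pc d
  · rw [mem_encode_of_isRayStart hdw hds]; simp
  · simp only [IsRayStart, not_or, not_not] at hds
    rw [← hds.2, hd]
    exact hp.pc_notMem_encode hpc hcw (rayPos_of_isRayStart (Or.inl hc))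

end IsParentFun

end TreeAsym

/-! ### From the tree to the parent function; the use of motion -/

namespace TreeAsym

variable {V : Type u}

namespace IsParentFun

variable {par : V → V} {w : V} {depth : V → ℕ}

theorem par_notMem_below (hp : IsParentFun par w depth) {c : V} (hc : c ≠ w) :
    par c ∉ below par c := by
  rintro ⟨n, hn⟩
  have h1 := hp.depth_iterate hc n hn
  have h2 := hp.depth_eq c hc
  omega

/-- Isomorphic branches at siblings can be swapped. -/
theorem exists_swap (hp : IsParentFun par w depth) {c c' : V} (hc : c ≠ w) (h : c' ∈ twins par c)
    (hne : c' ≠ c) : ∃ ψ : Equiv.Perm V, Function.Commute ψ par ∧ ψ c = c' ∧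
      ∀ x, ψ x ≠ x → x ∈ below par c ∪ below par c' := by
  classical
  have hc' := hp.ne_root_of_mem_twins hc h
  obtain ⟨hpar, φ, hφ, hφc⟩ := h
  have hdisj : ∀ x, x ∈ below par c → x ∉ below par c' := fun x hx hx' =>
    hne (hp.eq_of_mem_below hc' hc hpar hx' hx)
  have hto : ∀ x, x ∈ below par c → φ x ∈ below par c' := fun x hx => hφc ▸ map_mem_below hφ hx
  have hfrom : ∀ x, x ∈ below par c' → φ.symm x ∈ below par c := fun x hx => by
    simpa [← hφc] using map_mem_below (commute_symm hφ) hx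
  -- Using `φ` one way and its inverse the other makes this an involution, whatever `φ` does
  -- elsewhere.
  let σ : V → V := fun x =>
    if x ∈ below par c then φ x else if x ∈ below par c' then φ.symm x else x
  have hσ1 : ∀ x, x ∈ below par c → σ x = φ x := fun x hx => if_pos hx
  have hσ2 : ∀ x, x ∈ below par c' → σ x = φ.symm x := fun x hx => by
    simp only [σ, if_neg fun h => hdisj x h hx, if_pos hx]
  have hσ3 : ∀ x, x ∉ below par c → x ∉ below par c' → σ x = x := fun x h h' => by
    simp only [σ, if_neg h, if_neg h']
  have hinv : Function.Involutive σ := fun x => by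
    by_cases h1 : x ∈ below par c
    · rw [hσ1 x h1, hσ2 _ (hto x h1), Equiv.symm_apply_apply]
    by_cases h2 : x ∈ below par c'
    · rw [hσ2 x h2, hσ1 _ (hfrom x h2), Equiv.apply_symm_apply]
    · rw [hσ3 x h1 h2, hσ3 x h1 h2]
  have hpc : σ (par c) = par c := hσ3 _ (hp.par_notMem_below hc)
    (by rw [← hpar]; exact hp.par_notMem_below hc')
  refine ⟨hinv.toPerm σ, fun x => ?_, (hσ1 c (mem_below_self par c)).trans hφc, fun x hx => ?_⟩
  · change σ (par x) = par (σ x)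
    by_cases h1 : x ∈ below par c
    · rw [hσ1 x h1, ← hφ]
      by_cases hxc : x = c
      · rw [hxc, hpc, hφ, hφc, hpar]
      · rw [hσ1 _ (par_mem_below h1 hxc)]
    by_cases h2 : x ∈ below par c'
    · rw [hσ2 x h2, ← commute_symm hφ]
      by_cases hxc : x = c'
      · rw [hxc, hpar, hpc, ← hpar, commute_symm hφ, ← hφc, Equiv.symm_apply_apply, hφc, hpar]
      · rw [hσ2 _ (par_mem_below h2 hxc)]
    · rw [hσ3 x h1 h2, hσ3]
      · exact fun ⟨n, hn⟩ => h1 ⟨n + 1, hn⟩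
      · exact fun ⟨n, hn⟩ => h2 ⟨n + 1, hn⟩
  · by_contra hx'
    rw [Set.mem_union, not_or] at hx'
    exact hx (hσ3 x hx'.1 hx'.2)

end IsParentFun

/-- The parent is the next vertex on a shortest walk to `w`; uniqueness of paths leaves no second
neighbour closer to `w`. -/
theorem exists_isParentFun {T : SimpleGraph V} (hT : T.IsTree) (w : V) :
    ∃ par : V → V, IsParentFun par w (T.dist w) ∧
      ∀ u v, T.Adj u v ↔ u ≠ v ∧ (par u = v ∨ par v = u) := by
  have hex : ∀ v, ∃ p, (v = w → p = w) ∧ (v ≠ w → T.Adj p v ∧ T.dist w v = T.dist w p + 1) := by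
    intro v
    by_cases hv : v = w
    · exact ⟨w, fun _ => rfl, fun h => (h hv).elim⟩
    obtain ⟨q, hq⟩ := (hT.connected v w).exists_walk_length_eq_dist
    cases q with
    | nil => exact (hv rfl).elim
    | @cons _ p _ h q =>
      refine ⟨p, fun h => (hv h).elim, fun _ => ⟨h.symm, ?_⟩⟩
      have h1 := SimpleGraph.dist_le q
      rw [SimpleGraph.Walk.length_cons] at hq
      rw [SimpleGraph.dist_comm (u := w) (v := v), SimpleGraph.dist_comm (u := w) (v := p)]
      have h2 := hT.dist_eq_dist_add_one_of_adj w h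
      rw [SimpleGraph.dist_comm (u := w) (v := v), SimpleGraph.dist_comm (u := w) (v := p)] at h2
      omega
  have huniq : ∀ v p p', T.Adj p v → T.dist w v = T.dist w p + 1 → T.Adj p' v →
      T.dist w v = T.dist w p' + 1 → p = p' := by
    intro v p p' h hd h' hd'
    obtain ⟨q, hq⟩ := (hT.connected w p).exists_walk_length_eq_dist
    obtain ⟨q', hq'⟩ := (hT.connected w p').exists_walk_length_eq_dist
    have h1 : (q.concat h).IsPath := SimpleGraph.Walk.isPath_of_length_eq_dist _ (by simp [hq, hd])
    have h2 : (q'.concat h').IsPath :=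
      SimpleGraph.Walk.isPath_of_length_eq_dist _ (by simp [hq', hd'])
    have := (hT.existsUnique_path w v).unique h1 h2
    simpa using congrArg SimpleGraph.Walk.penultimate this
  choose par hroot hpar using hex
  refine ⟨par, ⟨hroot w rfl, fun v hv => (hpar v hv).2⟩, fun u v => ⟨fun h => ⟨h.ne, ?_⟩, ?_⟩⟩
  · have aux : ∀ u v, T.Adj u v → T.dist w u = T.dist w v + 1 → par u = v := fun u v h hd => by
      have hu : u ≠ w := by rintro rfl; simp at hd
      exact huniq u _ _ (hpar u hu).1 (hpar u hu).2 h.symm hd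
    exact (hT.dist_eq_dist_add_one_of_adj w h).imp (aux u v h) (aux v u h.symm)
  · have aux : ∀ u v, u ≠ v → par u = v → T.Adj u v := by
      rintro u v hne rfl
      have hu : u ≠ w := by rintro rfl; exact hne (hroot u rfl).symm
      exact (hpar u hu).1.symm
    rintro ⟨hne, h | h⟩
    · exact aux u v hne h
    · exact (aux v u hne.symm h).symm

section Tree

variable {T : SimpleGraph V} {par : V → V} {w : V} {depth : V → ℕ}

/-- A vertex of a double ray has two distinct neighbours on it, of which at most one is its parent.
-/
theorem exists_isChildFun (hp : IsParentFun par w depth)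
    (hadj : ∀ u v, T.Adj u v ↔ u ≠ v ∧ (par u = v ∨ par v = u))
    (hray : ∀ v : V, OnDoubleRay T v) : ∃ pc, IsChildFun par w pc := by
  have hex : ∀ v, ∃ c, c ≠ w ∧ par c = v := by
    intro v
    obtain ⟨f, hf, hf', n, rfl⟩ := hray v
    have h1 := (hadj _ _).1 (hf' n)
    have h2 := (hadj _ _).1 (hf' (n - 1))
    rw [sub_add_cancel] at h2
    have aux : ∀ c, c ≠ f n → par c = f n → ∃ c, c ≠ w ∧ par c = f n := by
      refine fun c hc h => ⟨c, ?_, h⟩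
      rintro rfl
      exact hc (hp.par_root ▸ h)
    rcases h1.2 with h3 | h3
    · rcases h2.2 with h4 | h4
      · exact aux _ h2.1 h4
      · have := hf (h3.symm.trans h4)
        omega
    · exact aux _ h1.1.symm h3
  choose pc hpc using hex
  exact ⟨pc, hpc⟩

theorem commute_of_iso (hp : IsParentFun par w depth)
    (hadj : ∀ u v, T.Adj u v ↔ u ≠ v ∧ (par u = v ∨ par v = u)) (φ : T ≃g T) (h : φ w = w) :
    Function.Commute φ.toEquiv par := by
  have key : ∀ n v, depth v = n → φ (par v) = par (φ v) := by
    intro n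
    induction n using Nat.strong_induction_on with
    | _ n ih =>
      rintro v rfl
      by_cases hv : v = w
      · rw [hv, hp.par_root, h, hp.par_root]
      have h1 : T.Adj (φ v) (φ (par v)) :=
        -- Otherwise `φ (par v)` would be a child of `φ v`, and by induction `par (par v) = v`,
        -- against the depths.
        φ.map_adj_iff.2 ((hadj _ _).2 ⟨(hp.par_ne hv).symm, Or.inl rfl⟩)
      rcases ((hadj _ _).1 h1).2 with h2 | h2
      · exact h2.symm
      have hd := hp.depth_eq v hv
      rw [← ih _ (by omega) (par v) rfl] at h2
      have h3 := φ.injective h2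
      by_cases hpw : par v = w
      · rw [hpw, hp.par_root] at h3
        exact (hv h3.symm).elim
      · have h4 := hp.depth_eq _ hpw
        rw [h3] at h4
        omega
  exact fun v => key _ v rfl

theorem exists_iso_of_commute (hadj : ∀ u v, T.Adj u v ↔ u ≠ v ∧ (par u = v ∨ par v = u))
    {φ : Equiv.Perm V} (h : Function.Commute φ par) : ∃ ψ : T ≃g T, ∀ x, ψ x = φ x :=
  ⟨⟨φ, fun {u v} => by simp only [hadj, ← h u, ← h v, φ.injective.eq_iff, ne_eq]⟩, fun _ => rfl⟩

/-- Swapping `c` with another twin moves at most two branches of equal size; as `m` is infinite,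
each has at least `m` vertices. Twins are neighbours of `par c`, hence at most `2 ^ m`. -/
theorem mk_twins_le (hp : IsParentFun par w depth)
    (hadj : ∀ u v, T.Adj u v ↔ u ≠ v ∧ (par u = v ∨ par v = u)) {m : Cardinal.{u}} (hm : ℵ₀ ≤ m)
    (hmotion : (m : WithTop Cardinal.{u}) ≤ motion T)
    (hdeg : ∀ v : V, #(T.neighborSet v) ≤ 2 ^ m) {c : V} (hc : c ≠ w) :
    #(twins par c) ≤ 2 ^ #(below par c) := by
  by_cases h : ∃ c' ∈ twins par c, c' ≠ c
  · obtain ⟨c', hc', hne⟩ := h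
    obtain ⟨ψ, hψ, hψc, hmove⟩ := hp.exists_swap hc hc' hne
    obtain ⟨φ, hφ⟩ := exists_iso_of_commute hadj hψ
    have h1 := (le_motion_iff T m).1 hmotion φ fun e => hne <| by
      rw [← hψc, ← hφ, e]; rfl
    have h2 : #(below par c') ≤ #(below par c) := by
      refine Cardinal.mk_le_of_injective
        (f := fun x => ⟨ψ.symm x, by
          simpa [← hψc] using map_mem_below (commute_symm hψ) x.2⟩) ?_
      intro x y hxy
      simpa [Subtype.ext_iff] using hxy
    have h3 : m ≤ #(below par c) := by
      by_contra hlt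
      have h4 : #{v | φ v ≠ v} ≤ #(below par c) + #(below par c') :=
        (Cardinal.mk_le_mk_of_subset fun x hx => hmove x (by rwa [← hφ])).trans
          (Cardinal.mk_union_le _ _)
      exact (h1.trans h4).not_gt
        (Cardinal.add_lt_of_lt hm (not_le.1 hlt) (h2.trans_lt (not_le.1 hlt)))
    calc #(twins par c) ≤ #(T.neighborSet (par c)) := Cardinal.mk_le_mk_of_subset fun d hd => by
          have hdw := hp.ne_root_of_mem_twins hc hd
          exact (hadj _ _).2 ⟨by rw [← hd.1]; exact hp.par_ne hdw, Or.inr hd.1⟩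
      _ ≤ 2 ^ m := hdeg _
      _ ≤ 2 ^ #(below par c) := Cardinal.power_le_power_left two_ne_zero h3
  · push Not at h
    have h1 : twins par c ⊆ {c} := fun d hd => h d hd
    refine (Cardinal.mk_le_mk_of_subset h1).trans ?_
    rw [Cardinal.mk_singleton]
    exact Cardinal.one_le_iff_ne_zero.2 (Cardinal.power_ne_zero _ two_ne_zero)

theorem numInequivalent_eq_two_power {F : Set (Set V)} (S : Set V → Set V) (hS : ∀ A, S A ∈ F)
    (h : ∀ A B, ∀ φ : T ≃g T, φ '' S A = S B → A = B) : numInequivalent T F = 2 ^ #V := by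
  rw [← Cardinal.mk_set]
  apply le_antisymm
  · exact Cardinal.mk_image_le.trans (Cardinal.mk_set_le _)
  · refine Cardinal.mk_le_of_injective
      (f := fun A => ⟨Quotient.mk (equivalentSets T) (S A), S A, hS A, rfl⟩) fun A B hAB => ?_
    obtain ⟨φ, hφ⟩ := Quotient.exact (Subtype.ext_iff.1 hAB)
    exact h A B φ hφ

theorem image_eq_iff {φ : T ≃g T} {S S' : Set V} : φ '' S = S' ↔ ∀ v, φ v ∈ S' ↔ v ∈ S := by
  constructor
  · rintro rfl v
    exact φ.injective.mem_set_image
  · intro h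
    ext v
    obtain ⟨v, rfl⟩ := φ.surjective v
    rw [φ.injective.mem_set_image, h]

/-- Each vertex set `A` is encoded in a colouring that no non-trivial automorphism fixing the root
preserves. -/
theorem exists_encoding (hp : IsParentFun par w depth)
    (hadj : ∀ u v, T.Adj u v ↔ u ≠ v ∧ (par u = v ∨ par v = u)) {pc : V → V}
    (hpc : IsChildFun par w pc) (h : ∀ c, c ≠ w → #(twins par c) ≤ 2 ^ #(below par c)) :
    ∃ x : Set V → V → Palette, ∀ b A B, ∀ φ : T ≃g T, φ w = w →
      φ '' encode par w pc b (x A) = encode par w pc b (x B) → A = B ∧ φ = RelIso.refl _ := by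
  classical
  obtain ⟨e, he⟩ := exists_pack
  obtain ⟨f, hf⟩ := hp.exists_rigid_root h
  -- The code does not store the colour of the root, so every other vertex also records whether `w ∈
  -- A`.
  refine ⟨fun A v => e fun n => if n = 0 then f v else fun k =>
    if k = 0 then decide (v ∈ A) else decide (w ∈ A), fun b A B φ hw hφ => ?_⟩
  have hcomm := commute_of_iso hp hadj φ hw
  have hcol : ∀ v, v ≠ w → f (φ v) = f v ∧ (φ v ∈ B ↔ v ∈ A) ∧ (w ∈ B ↔ w ∈ A) := fun v hv => by
    have h1 := he (hp.eq_of_map_encode hpc hcomm (image_eq_iff.1 hφ) hv)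
    have h2 := congrFun h1 0
    have h3 := congrFun (congrFun h1 1) 0
    have h4 := congrFun (congrFun h1 1) 1
    exact ⟨by simpa using h2, by simpa using h3, by simpa using h4⟩
  have hid : ∀ v, φ v = v := hf φ.toEquiv hcomm fun v => by
    by_cases hv : v = w
    · exact congrArg f (by rw [hv]; exact hw)
    · exact (hcol v hv).1
  refine ⟨?_, RelIso.ext hid⟩
  ext v
  by_cases hv : v = w
  · rw [hv]; exact (hcol _ (hpc w).1).2.2.symm
  · have := (hcol v hv).2.1
    rw [hid] at this
    exact this.symm

end Tree

/-! ### Recognising the root from the code -/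

/-- No vertex of `S` is at distance at most two from `v`. -/
def FarFrom (T : SimpleGraph V) (S : Set V) (v : V) : Prop :=
  v ∉ S ∧ ∀ c, T.Adj v c → c ∉ S ∧ ∀ d, T.Adj c d → d ∉ S

theorem FarFrom.map {T : SimpleGraph V} {S S' : Set V} {v : V} (h : FarFrom T S v) {φ : T ≃g T}
    (hφ : ∀ v, φ v ∈ S' ↔ v ∈ S) : FarFrom T S' (φ v) := by
  refine ⟨by rw [hφ]; exact h.1, fun c hc => ?_⟩
  obtain ⟨c, rfl⟩ := φ.surjective c
  rw [φ.map_adj_iff] at hc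
  refine ⟨by rw [hφ]; exact (h.2 c hc).1, fun d hd => ?_⟩
  obtain ⟨d, rfl⟩ := φ.surjective d
  rw [φ.map_adj_iff] at hd
  rw [hφ]
  exact (h.2 c hc).2 d hd

theorem HasNeighborOutside.map {T : SimpleGraph V} {S S' : Set V} {v : V}
    (h : HasNeighborOutside T S v) {φ : T ≃g T} (hφ : ∀ v, φ v ∈ S' ↔ v ∈ S) :
    HasNeighborOutside T S' (φ v) := by
  obtain ⟨u, hu, hu'⟩ := h
  exact ⟨φ u, φ.map_adj_iff.2 hu, by rwa [hφ]⟩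

section Code

variable {T : SimpleGraph V} {par : V → V} {w : V} {depth : V → ℕ} {pc : V → V}
  {x : V → Palette}

theorem hasNeighborOutside_encode (hp : IsParentFun par w depth)
    (hadj : ∀ u v, T.Adj u v ↔ u ≠ v ∧ (par u = v ∨ par v = u)) (hpc : IsChildFun par w pc)
    {b : Bool} {v : V} (hv : v ≠ w) (h : v ∈ encode par w pc b x) :
    HasNeighborOutside T (encode par w pc b x) v := by
  rcases hp.exists_notMem_encode hpc hv h with h | h
  · refine ⟨pc v, (hadj _ _).2 ⟨fun e => ?_, Or.inr (hpc v).2⟩, h⟩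
    have := hp.par_ne hv
    rw [e, (hpc v).2] at this
    exact this e
  · exact ⟨par v, (hadj _ _).2 ⟨(hp.par_ne hv).symm, Or.inl rfl⟩, h⟩

/-- With `b` false the code avoids `w`, its children and grandchildren, whereas any other vertex
meets the code within two steps along chosen children. -/
theorem farFrom_encode_iff (hp : IsParentFun par w depth)
    (hadj : ∀ u v, T.Adj u v ↔ u ≠ v ∧ (par u = v ∨ par v = u)) (hpc : IsChildFun par w pc)
    {v : V} : FarFrom T (encode par w pc false x) v ↔ v = w := by
  constructor
  · intro h
    by_contra hv
    have hadj' : ∀ u, T.Adj u (pc u) := fun u => (hadj _ _).2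
      ⟨fun e => hp.par_ne (hpc u).1 (by rw [(hpc u).2]; exact e), Or.inr (hpc u).2⟩
    rcases hp.exists_mem_encode hpc (b := false) (x := x) hv with h1 | h1 | h1
    · exact h.1 h1
    · exact (h.2 _ (hadj' v)).1 h1
    · exact (h.2 _ (hadj' v)).2 _ (hadj' _) h1
  · rintro rfl
    have hw := hp.far_root_notMem_encode (x := x) hpc hp.par_root hp.par_root
    refine ⟨hw.1, fun c hc => ?_⟩
    have hcw : par c = v := by
      rcases ((hadj _ _).1 hc).2 with h | h
      · exact (hc.ne (hp.par_root.symm.trans h)).elim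
      · exact h
    refine ⟨(hp.far_root_notMem_encode hpc hcw (hpc c).2).1, fun d hd => ?_⟩
    rcases ((hadj _ _).1 hd).2 with h | h
    · rw [← h, hcw]; exact hw.1
    · exact (hp.far_root_notMem_encode hpc hcw h).2

/-- With `b` true, `w` and all its children lie in the code; any other member has an outside
neighbour on its ray. -/
theorem setOf_not_hasNeighborOutside_encode (hp : IsParentFun par w depth)
    (hadj : ∀ u v, T.Adj u v ↔ u ≠ v ∧ (par u = v ∨ par v = u)) (hpc : IsChildFun par w pc) :
    {v | v ∈ encode par w pc true x ∧ ¬ HasNeighborOutside T (encode par w pc true x) v} = {w} := by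
  ext v
  constructor
  · rintro ⟨h, h'⟩
    by_contra hv
    exact h' (hasNeighborOutside_encode hp hadj hpc hv h)
  · rintro rfl
    refine ⟨IsParentFun.root_mem_encode.2 rfl, ?_⟩
    rintro ⟨c, hc, hc'⟩
    rcases ((hadj _ _).1 hc).2 with h | h
    · exact hc.ne (hp.par_root.symm.trans h)
    · exact hc' ((IsParentFun.mem_encode_of_isRayStart hc.ne' (Or.inl h)).2 ⟨h, rfl⟩)

end Code

end TreeAsym

/-! ### Assembly: `b` false for the first count, `b` true for the second -/

theorem mainTheorem5 {V : Type u} (T : SimpleGraph V) (hT : T.IsTree)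
    (m : Cardinal.{u}) (hm : ℵ₀ ≤ m)
    (hmotion : (m : WithTop Cardinal.{u}) ≤ TreeAsym.motion T)
    (hdeg : ∀ v : V, #(T.neighborSet v) ≤ 2 ^ m)
    (hray : ∀ v : V, TreeAsym.OnDoubleRay T v) :
    TreeAsym.numInequivalent T
        {S | TreeAsym.IsAsymmetrizing T S ∧ ∀ v ∈ S, TreeAsym.HasNeighborOutside T S v} =
      2 ^ #V ∧
    ∀ w : V,
      TreeAsym.numInequivalent T
          {S | TreeAsym.IsAsymmetrizing T S ∧
            {v | v ∈ S ∧ ¬ TreeAsym.HasNeighborOutside T S v} = {w}} =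
        2 ^ #V := by
  have key : ∀ w : V, ∃ (par pc : V → V) (x : Set V → V → TreeAsym.Palette),
      TreeAsym.IsParentFun par w (T.dist w) ∧ TreeAsym.IsChildFun par w pc ∧
      (∀ u v, T.Adj u v ↔ u ≠ v ∧ (par u = v ∨ par v = u)) ∧
      ∀ b A B, ∀ φ : T ≃g T, φ w = w →
        φ '' TreeAsym.encode par w pc b (x A) = TreeAsym.encode par w pc b (x B) →
          A = B ∧ φ = RelIso.refl _ := by
    intro w
    obtain ⟨par, hp, hadj⟩ := TreeAsym.exists_isParentFun hT w
    obtain ⟨pc, hpc⟩ := TreeAsym.exists_isChildFun hp hadj hray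
    obtain ⟨x, hx⟩ := TreeAsym.exists_encoding hp hadj hpc fun c hc =>
      TreeAsym.mk_twins_le hp hadj hm hmotion hdeg hc
    exact ⟨par, pc, x, hp, hpc, hadj, hx⟩
  constructor
  · obtain ⟨w⟩ := hT.connected.nonempty
    obtain ⟨par, pc, x, hp, hpc, hadj, hx⟩ := key w
    have hw : ∀ A B, ∀ φ : T ≃g T, φ '' TreeAsym.encode par w pc false (x A) =
        TreeAsym.encode par w pc false (x B) → φ w = w := fun A B φ hφ =>
      (TreeAsym.farFrom_encode_iff hp hadj hpc).1
        (((TreeAsym.farFrom_encode_iff hp hadj hpc).2 rfl).map (TreeAsym.image_eq_iff.1 hφ))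
    refine TreeAsym.numInequivalent_eq_two_power
      (fun A => TreeAsym.encode par w pc false (x A)) (fun A => ⟨fun φ hφ => ?_, fun v hv => ?_⟩)
      fun A B φ hφ => (hx false A B φ (hw A B φ hφ) hφ).1
    · exact (hx false A A φ (hw A A φ hφ) hφ).2
    · refine TreeAsym.hasNeighborOutside_encode hp hadj hpc ?_ hv
      rintro rfl
      exact absurd (TreeAsym.IsParentFun.root_mem_encode.1 hv) (by simp)
  · intro w
    obtain ⟨par, pc, x, hp, hpc, hadj, hx⟩ := key w
    have hset := fun A =>
      TreeAsym.setOf_not_hasNeighborOutside_encode (x := x A) hp hadj hpc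
    have hw : ∀ A B, ∀ φ : T ≃g T, φ '' TreeAsym.encode par w pc true (x A) =
        TreeAsym.encode par w pc true (x B) → φ w = w := fun A B φ hφ => by
      have h1 := (hset A).ge (Set.mem_singleton w)
      have hmem := TreeAsym.image_eq_iff.1 hφ
      -- An outside neighbour of `φ w` would pull back along `φ.symm` to one of `w`.
      refine (hset B).le ⟨(hmem w).2 h1.1, fun h => h1.2 ?_⟩
      have hsymm : ∀ v, φ.symm v ∈ TreeAsym.encode par w pc true (x A) ↔
          v ∈ TreeAsym.encode par w pc true (x B) := fun v => by
        rw [← hmem, RelIso.apply_symm_apply]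
      simpa using h.map hsymm
    exact TreeAsym.numInequivalent_eq_two_power
      (fun A => TreeAsym.encode par w pc true (x A))
      (fun A => ⟨fun φ hφ => (hx true A A φ (hw A A φ hφ) hφ).2, hset A⟩)
      fun A B φ hφ => (hx true A B φ (hw A B φ hφ) hφ).1
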